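/- Let $\lambda_1,\lambda_2\in\mathbb R$, $\lambda_3>0$ and $p\in(4,6]$. For $u\in H^1(\mathbb R^3;\mathbb C)$ define the energy (without external potential) $$E(u)=\frac12\|\nabla u\|_2^2+\frac12\,\frac1{(2\pi)^3}\int_{\mathbb R^3}\big(\lambda_1+\lambda_2\widehat K(\xi)\big)\,\big|\widehat{|u|^2}(\xi)\big|^2\,d\xi+\frac{2}{p}\,\lambda_3\|u\|_p^p,$$ where $\widehat f(\xi)=\int_{\mathbb R^3}f(x)e^{-ix\cdot\xi}\,dx$ for integrable $f$ and $$\widehat K(\xi)=\frac{4\pi}{3}\,\frac{2\xi_3^2-\xi_1^2-\xi_2^2}{|\xi|^2}$$ is the Fourier symbol of the dipolar kernel $K(x)=(x_1^2+x_2^2-2x_3^2)/|x|^5$. For $c>0$ let $$S(c)=\{u\in H^1(\mathbb R^3;\mathbb C):\|u\|_2^2=c\},\qquad \gamma(c)=\inf_{u\in S(c)}E(u),$$ and put $\gamma(0)=0$. Then $\gamma(c)$ is a finite real number for every $c>0$, and: 1. the function $\gamma:[0,\infty)\to\mathbb R$ is concave and continuous; 2. if there exist $c_1,c_2\in(0,\infty)$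 with $\gamma(c_1+c_2)=\gamma(c_1)+\gamma(c_2)$, then $\gamma$ is linear on $[0,c_1+c_2]$, i.e. there is $m\in\mathbb R$ with $\gamma(c)=mc$ for all $c\in[0,c_1+c_2]$. -/

import Mathlib

open MeasureTheory

namespace DipolarGP

/-- Physical space `ℝ³` with its Euclidean norm; the coordinates `x₁, x₂, x₃` are
`x 0, x 1, x 2`. -/
abbrev R3 : Type := EuclideanSpace ℝ (Fin 3)

/-- Test functions: real-valued, smooth, compactly supported. -/
def IsTest (φ : R3 → ℝ) : Prop :=
  ContDiff ℝ (⊤ : ℕ∞) φ ∧ HasCompactSupport φ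

/-- `g = (g₀, g₁, g₂)` is a square-integrable weak (distributional) gradient of `u`. -/
def IsWeakGradient (u : R3 → ℂ) (g : Fin 3 → R3 → ℂ) : Prop :=
  ∀ j : Fin 3, MemLp (g j) 2 volume ∧
    ∀ φ : R3 → ℝ, IsTest φ →
      ∫ x, ((fderiv ℝ φ x (EuclideanSpace.single j 1) : ℝ) : ℂ) * u x
        = - ∫ x, ((φ x : ℝ) : ℂ) * g j x

/-- The Sobolev space `H¹(ℝ³; ℂ)`. -/
def MemH1 (u : R3 → ℂ) : Prop :=
  MemLp u 2 volume ∧ ∃ g, IsWeakGradient u g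

/-- The components of a weak gradient are unique up to null sets. -/
theorem IsWeakGradient.ae_eq {u : R3 → ℂ} {g h : Fin 3 → R3 → ℂ}
    (hg : IsWeakGradient u g) (hh : IsWeakGradient u h) (j : Fin 3) :
    g j =ᵐ[volume] h j := by
  have lg : LocallyIntegrable (g j) volume := (hg j).1.locallyIntegrable (by norm_num)
  have lh : LocallyIntegrable (h j) volume := (hh j).1.locallyIntegrable (by norm_num)
  refine ae_eq_of_integral_contDiff_smul_eq lg lh ?_
  intro φ hφ hc
  have e1 := (hg j).2 φ ⟨hφ, hc⟩
  have e2 := (hh j).2 φ ⟨hφ, hc⟩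
  simpa [Complex.real_smul] using neg_injective (e1.symm.trans e2)

open Classical in
/-- The weak gradient of `u ∈ H¹` (defined up to null sets; `0` if there is none). -/
noncomputable def weakGradient (u : R3 → ℂ) : Fin 3 → R3 → ℂ :=
  if h : ∃ g, IsWeakGradient u g then h.choose else 0

/-- `A(u) = ‖∇u‖₂²`. -/
noncomputable def A (u : R3 → ℂ) : ℝ :=
  ∫ x, ∑ j : Fin 3, ‖weakGradient u j x‖ ^ 2

/-- `A(u)` may be computed with any weak gradient of `u`. -/
theorem A_eq {u : R3 → ℂ} {g : Fin 3 → R3 → ℂ} (hg : IsWeakGradient u g) :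
    A u = ∫ x, ∑ j : Fin 3, ‖g j x‖ ^ 2 := by
  have hex : ∃ g, IsWeakGradient u g := ⟨g, hg⟩
  have hw : IsWeakGradient u (weakGradient u) := by
    rw [weakGradient, dif_pos hex]
    exact hex.choose_spec
  refine integral_congr_ae ?_
  filter_upwards [ae_all_iff.2 fun j => hw.ae_eq hg j] with x hx
  simp only [hx]

/-- The Fourier transform `∫ f(x) e^{-i x·ξ} dx` (no `2π` in the exponent). -/
noncomputable def fourierR3 (f : R3 → ℂ) (ξ : R3) : ℂ :=
  ∫ x, Complex.exp (-(Complex.I * ((inner ℝ x ξ : ℝ) : ℂ))) * f x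

/-- The Fourier symbol of the dipolar kernel `K(x) = (x₁² + x₂² - 2 x₃²) / |x|⁵`. -/
noncomputable def Khat (ξ : R3) : ℝ :=
  4 * Real.pi / 3 * ((2 * ξ 2 ^ 2 - ξ 0 ^ 2 - ξ 1 ^ 2) / ‖ξ‖ ^ 2)

/-- `B(u) = (2π)⁻³ ∫ (λ₁ + λ₂ K̂(ξ)) |𝓕(|u|²)(ξ)|² dξ`. -/
noncomputable def B (l1 l2 : ℝ) (u : R3 → ℂ) : ℝ :=
  1 / (2 * Real.pi) ^ 3 *
    ∫ ξ, (l1 + l2 * Khat ξ) * ‖fourierR3 (fun x => ((‖u x‖ ^ 2 : ℝ) : ℂ)) ξ‖ ^ 2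

/-- `C(u) = λ₃ ‖u‖_p^p`. -/
noncomputable def C (l3 p : ℝ) (u : R3 → ℂ) : ℝ :=
  l3 * ∫ x, ‖u x‖ ^ p

/-- The energy `E = A/2 + B/2 + (2/p) C`, without external potential. -/
noncomputable def energy (l1 l2 l3 p : ℝ) (u : R3 → ℂ) : ℝ :=
  1 / 2 * A u + 1 / 2 * B l1 l2 u + 2 / p * C l3 p u

/-- The constraint set `S(c) = {u ∈ H¹ : ‖u‖₂² = c}`. -/
def S (c : ℝ) : Set (R3 → ℂ) :=
  {u | MemH1 u ∧ ∫ x, ‖u x‖ ^ 2 = c}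

open Classical in
/-- The infimum function: `γ(0) = 0` and `γ(c) = inf_{u ∈ S(c)} E(u)` for `c > 0`
(only used on `[0, ∞)`). -/
noncomputable def gamma (l1 l2 l3 p : ℝ) (c : ℝ) : ℝ :=
  if c = 0 then 0 else sInf (energy l1 l2 l3 p '' S c)

end DipolarGP

/-!
The proof rests on a scaling argument. If `u` has mass `c`, its dilate `x ↦ u (t^{-1/3} x)` has mass
`t c`. The symbol `K̂` is homogeneous of degree zero, so the interaction terms `B` and `C` scale by
`t`, while the kinetic term scales by `t^{1/3}` (`energy_dilation`). With `A = A(u)` and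
`D = B(u)/2 + (2/p) C(u)`, therefore

  `γ(t c) ≤ t^{1/3} A / 2 + t D`,

a concave function of `t ≥ 0` which equals `E(u)` at `t = 1` (`gamma_mul_le`). Since every `u` of
mass `c` gives such a bound, `γ` is an infimum of concave functions vanishing at `0`, and thus
concave on `[0, ∞)` (`concaveOn_gamma`). Concavity gives continuity on `(0, ∞)`; at `0` the
function is squeezed between a chord and one of the concave bounds. The linearity statement is a
general fact about concave functions vanishing at the origin
(`ConcaveOn.exists_eq_mul_of_add_eq`).

It remains to see that `γ` is finite (`exists_energy_lower_bound`). By Plancherel and the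
boundedness of `K̂`, the dipolar term is controlled by `∫ |u|⁴` (`abs_B_le`), and as `2 < 4 < p`
this is absorbed by `∫ |u|^p` and `∫ |u|²`. For these integrals to be finite for all `u ∈ H¹`
one needs the Sobolev embedding `H¹ ⊂ L⁶` (`MemH1.memLp_six`), obtained from the
Gagliardo–Nirenberg–Sobolev inequality for smooth compactly supported functions by mollification,
truncation and Fatou's lemma.
-/

/-! ### Concave functions on the half-line -/

/-- For a concave `f` with `f 0 = 0` the slope `f c / c` is nonincreasing, so `f (a + b) = f a + f b`
forces the slopes at `a`, `b` and `a + b` to agree; `f` then meets a chord at an interior point and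
is linear. -/
theorem ConcaveOn.exists_eq_mul_of_add_eq {f : ℝ → ℝ} (hf : ConcaveOn ℝ (Set.Ici 0) f)
    (h0 : f 0 = 0) {a b : ℝ} (ha : 0 < a) (hb : 0 < b) (hab : f (a + b) = f a + f b) :
    ∃ m : ℝ, ∀ c ∈ Set.Icc 0 (a + b), f c = m * c := by
  have hT : 0 < a + b := by linarith
  -- Weighted form of the concavity inequality, free of divisions.
  have key : ∀ x y z : ℝ, 0 ≤ x → x ≤ y → y ≤ z → (z - y) * f x + (y - x) * f z ≤ (z - x) * f y := by
    intro x y z hx hxy hyz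
    rcases (hxy.trans hyz).eq_or_lt with h | h
    · have h1 : y = x := by linarith
      subst h1; subst h; simp
    have hzx : 0 < z - x := sub_pos.2 h
    have h := hf.2 (Set.mem_Ici.2 hx) (Set.mem_Ici.2 (hx.trans (hxy.trans hyz)))
      (div_nonneg (sub_nonneg.2 hyz) hzx.le) (div_nonneg (sub_nonneg.2 hxy) hzx.le)
      (by field_simp; ring)
    simp only [smul_eq_mul] at h
    have e : (z - y) / (z - x) * x + (y - x) / (z - x) * z = y := by field_simp; ring
    rw [e] at h
    have h2 := mul_le_mul_of_nonneg_left h hzx.le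
    have e2 : (z - x) * ((z - y) / (z - x) * f x + (y - x) / (z - x) * f z)
        = (z - y) * f x + (y - x) * f z := by field_simp
    linarith
  have ka := key 0 a (a + b) le_rfl ha.le (by linarith)
  have kb := key 0 b (a + b) le_rfl hb.le (by linarith)
  simp only [h0, mul_zero, zero_add, sub_zero] at ka kb
  obtain ⟨m, hm⟩ : ∃ m, f (a + b) = m * (a + b) := ⟨f (a + b) / (a + b), by field_simp⟩
  have hfa : f a = m * a := by
    refine mul_left_cancel₀ hT.ne' ?_
    rw [hm] at ka kb hab
    nlinarith
  refine ⟨m, fun c hc => ?_⟩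
  have kc := key 0 c (a + b) le_rfl hc.1 hc.2
  simp only [h0, mul_zero, zero_add, sub_zero] at kc
  have hge : m * c ≤ f c := by
    rw [hm] at kc
    refine le_of_mul_le_mul_left ?_ hT
    linarith
  refine le_antisymm ?_ hge
  rcases le_total c a with hca | hac
  · have k := key c a (a + b) hc.1 hca (by linarith)
    rw [hm, hfa] at k
    refine le_of_mul_le_mul_left ?_ hb
    linarith
  · have k := key 0 a c le_rfl ha.le hac
    simp only [h0, mul_zero, zero_add, sub_zero] at k
    rw [hfa] at k
    refine le_of_mul_le_mul_left ?_ ha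
    linarith

namespace DipolarGP

/-! ### Plancherel's theorem on `L¹ ∩ L²` -/

section Plancherel

open scoped FourierTransform

/-- The `L²` Fourier transform agrees with the Fourier integral on `L¹ ∩ L²`: both represent the
same tempered distribution. -/
theorem fourier_toLp_ae_eq {f : R3 → ℂ} (h1 : Integrable f) (h2 : MemLp f 2 volume) :
    ((𝓕 (h2.toLp f) : Lp ℂ 2 (volume : Measure R3)) : R3 → ℂ) =ᵐ[volume] 𝓕 f := by
  have hcont : Continuous (𝓕 f : R3 → ℂ) :=
    VectorFourier.fourierIntegral_continuous Real.continuous_fourierChar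
      (by exact continuous_inner) h1
  refine ae_eq_of_integral_contDiff_smul_eq
    ((Lp.memLp _).locallyIntegrable (by norm_num)) hcont.locallyIntegrable ?_
  intro φ hφ hc
  have hφ' : ContDiff ℝ (⊤ : ℕ∞) (fun x => (φ x : ℂ)) := Complex.ofRealCLM.contDiff.comp hφ
  have hc' : HasCompactSupport (fun x => (φ x : ℂ)) := hc.comp_left (g := ((↑) : ℝ → ℂ)) (by simp)
  let Φ : SchwartzMap R3 ℂ := hc'.toSchwartzMap hφ'
  have hΦ : ∀ x, Φ x = φ x := fun x => rfl
  have key := congrArg (fun T : TemperedDistribution R3 ℂ => T Φ)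
    (Lp.fourier_toTemperedDistribution_eq (h2.toLp f))
  simp only [TemperedDistribution.fourier_apply, Lp.toTemperedDistribution_apply] at key
  have e1 : ∫ x, φ x • ((𝓕 (h2.toLp f) : Lp ℂ 2 (volume : Measure R3)) : R3 → ℂ) x
      = ∫ x, Φ x • ((𝓕 (h2.toLp f) : Lp ℂ 2 (volume : Measure R3)) : R3 → ℂ) x := by
    simp only [hΦ, Complex.real_smul, smul_eq_mul]
  have e2 : ∫ x, (𝓕 Φ) x • (h2.toLp f) x = ∫ x, (𝓕 (Φ : R3 → ℂ)) x • f x := by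
    refine integral_congr_ae ?_
    filter_upwards [h2.coeFn_toLp] with x hx
    rw [hx, SchwartzMap.fourier_coe]
  have e3 : ∫ x, (𝓕 (Φ : R3 → ℂ)) x • f x = ∫ x, Φ x • (𝓕 f) x := by
    have := VectorFourier.integral_fourierIntegral_smul_eq_flip (L := innerₗ R3)
      (μ := volume) (ν := volume) (f := (Φ : R3 → ℂ)) (g := f) Real.continuous_fourierChar
      (by exact continuous_inner) Φ.integrable h1
    rw [flip_innerₗ] at this
    exact this
  have e4 : ∫ x, Φ x • (𝓕 f) x = ∫ x, φ x • (𝓕 f) x := by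
    simp only [hΦ, Complex.real_smul, smul_eq_mul]
  exact e1.trans (key.symm.trans (e2.trans (e3.trans e4)))

/-- Plancherel's theorem for the Fourier integral of a function in `L¹ ∩ L²`. -/
theorem integral_norm_sq_fourier {f : R3 → ℂ} (h1 : Integrable f) (h2 : MemLp f 2 volume) :
    Integrable (fun ξ => ‖𝓕 f ξ‖ ^ 2) ∧ ∫ ξ, ‖𝓕 f ξ‖ ^ 2 = ∫ x, ‖f x‖ ^ 2 := by
  have hae := fourier_toLp_ae_eq h1 h2
  have hm : MemLp (𝓕 f) 2 (volume : Measure R3) :=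
    (memLp_congr_ae hae).1 (Lp.memLp _)
  refine ⟨hm.integrable_norm_pow (by norm_num), ?_⟩
  have hsq : ∀ F : Lp ℂ 2 (volume : Measure R3), ∫ x, ‖F x‖ ^ 2 = ‖F‖ ^ 2 := by
    intro F
    have := L2.inner_def (𝕜 := ℂ) F F
    rw [inner_self_eq_norm_sq_to_K] at this
    simp only [inner_self_eq_norm_sq_to_K] at this
    have h3 : ((‖F‖ ^ 2 : ℝ) : ℂ) = ((∫ x, ‖F x‖ ^ 2 : ℝ) : ℂ) := by
      rw [← integral_complex_ofReal]
      simpa using this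
    exact (Complex.ofReal_injective h3).symm
  calc ∫ ξ, ‖𝓕 f ξ‖ ^ 2 = ∫ ξ, ‖(𝓕 (h2.toLp f) : Lp ℂ 2 (volume : Measure R3)) ξ‖ ^ 2 := by
        refine integral_congr_ae ?_
        filter_upwards [hae] with x hx
        rw [hx]
    _ = ∫ x, ‖(h2.toLp f) x‖ ^ 2 := by
        rw [hsq, hsq, Lp.norm_fourier_eq]
    _ = ∫ x, ‖f x‖ ^ 2 := by
        refine integral_congr_ae ?_
        filter_upwards [h2.coeFn_toLp] with x hx
        rw [hx]

theorem fourierR3_eq (f : R3 → ℂ) (ξ : R3) :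
    fourierR3 f ξ = 𝓕 f ((2 * Real.pi)⁻¹ • ξ) := by
  rw [fourierR3, Real.fourier_eq]
  refine integral_congr_ae (Filter.Eventually.of_forall fun x => ?_)
  simp only [Circle.smul_def, smul_eq_mul, Real.fourierChar_apply, inner_smul_right]
  congr 2
  have : (Real.pi : ℂ) ≠ 0 := by exact_mod_cast Real.pi_ne_zero
  push_cast
  field_simp

/-- Plancherel's theorem in the normalisation without `2π` in the exponent. -/
theorem integral_norm_sq_fourierR3 {f : R3 → ℂ} (h1 : Integrable f) (h2 : MemLp f 2 volume) :
    Integrable (fun ξ => ‖fourierR3 f ξ‖ ^ 2) ∧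
      ∫ ξ, ‖fourierR3 f ξ‖ ^ 2 = (2 * Real.pi) ^ 3 * ∫ x, ‖f x‖ ^ 2 := by
  have h := integral_norm_sq_fourier h1 h2
  have hpi : 0 ≤ 2 * Real.pi := by positivity
  simp only [fourierR3_eq]
  refine ⟨h.1.comp_smul (by positivity), ?_⟩
  rw [Measure.integral_comp_inv_smul_of_nonneg volume (fun ξ => ‖𝓕 f ξ‖ ^ 2) hpi, h.2]
  simp

end Plancherel

/-! ### The dipolar symbol and the bound on the interaction -/

theorem norm_sq_eq (ξ : R3) : ‖ξ‖ ^ 2 = ξ 0 ^ 2 + ξ 1 ^ 2 + ξ 2 ^ 2 := by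
  rw [EuclideanSpace.norm_sq_eq, Fin.sum_univ_three]
  simp

theorem abs_Khat_le (ξ : R3) : |Khat ξ| ≤ 8 * Real.pi / 3 := by
  have hpi := Real.pi_pos
  have h : |(2 * ξ 2 ^ 2 - ξ 0 ^ 2 - ξ 1 ^ 2) / ‖ξ‖ ^ 2| ≤ 2 := by
    rw [abs_div, abs_of_nonneg (sq_nonneg ‖ξ‖)]
    refine div_le_of_le_mul₀ (sq_nonneg _) (by norm_num) ?_
    rw [norm_sq_eq, abs_le]
    constructor <;> nlinarith [sq_nonneg (ξ 0), sq_nonneg (ξ 1), sq_nonneg (ξ 2)]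
  rw [Khat, abs_mul, abs_of_pos (by positivity)]
  nlinarith

theorem Khat_smul {t : ℝ} (ht : t ≠ 0) (ξ : R3) : Khat (t • ξ) = Khat ξ := by
  have h : ∀ a b c d : ℝ, (2 * (t * a) ^ 2 - (t * b) ^ 2 - (t * c) ^ 2) / (t ^ 2 * d)
      = (2 * a ^ 2 - b ^ 2 - c ^ 2) / d := by
    intro a b c d
    rw [← mul_div_mul_left _ d (pow_ne_zero 2 ht)]
    congr 1
    ring
  simp [Khat, norm_smul, mul_pow, ← h]

/-- By Plancherel, the dipolar interaction is controlled by the quartic norm. -/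
theorem abs_B_le (l1 l2 : ℝ) {u : R3 → ℂ} (h2 : MemLp u 2 volume) (h4 : MemLp u 4 volume) :
    |B l1 l2 u| ≤ (|l1| + |l2| * (8 * Real.pi / 3)) * ∫ x, ‖u x‖ ^ 4 := by
  set f : R3 → ℂ := fun x => ((‖u x‖ ^ 2 : ℝ) : ℂ) with hf
  have h1 : Integrable f := (h2.integrable_norm_pow (by norm_num)).ofReal
  have hf2 : MemLp f 2 volume := by
    have h : MemLp (fun x => ‖u x‖ ^ (2 : ℝ)) 2 volume := by
      have := h4.norm_rpow_div (2 : ENNReal)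
      have e : (4 : ENNReal) / 2 = 2 := by
        rw [show (4 : ENNReal) = 2 * 2 by norm_num]
        exact ENNReal.mul_div_cancel_right (by norm_num) (by norm_num)
      simpa [e] using this
    have := h.ofReal (K := ℂ)
    simpa [hf] using this
  obtain ⟨hi, he⟩ := integral_norm_sq_fourierR3 h1 hf2
  have hfn : ∀ x, ‖f x‖ ^ 2 = ‖u x‖ ^ 4 := fun x => by
    rw [hf]; simp only [Complex.norm_real, norm_pow, norm_norm]; ring
  simp only [hfn] at he
  have hpi : 0 < (2 * Real.pi) ^ 3 := by positivity
  have hb : |∫ ξ, (l1 + l2 * Khat ξ) * ‖fourierR3 f ξ‖ ^ 2|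
      ≤ (|l1| + |l2| * (8 * Real.pi / 3)) * ((2 * Real.pi) ^ 3 * ∫ x, ‖u x‖ ^ 4) := by
    rw [← he, ← integral_const_mul, ← Real.norm_eq_abs]
    refine norm_integral_le_of_norm_le (hi.const_mul _) (Filter.Eventually.of_forall fun ξ => ?_)
    rw [norm_mul, norm_pow, norm_norm, Real.norm_eq_abs]
    gcongr
    calc |l1 + l2 * Khat ξ| ≤ |l1| + |l2 * Khat ξ| := abs_add_le _ _
      _ ≤ _ := by rw [abs_mul]; gcongr; exact abs_Khat_le ξ
  rw [B, abs_mul, abs_of_pos (by positivity)]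
  calc _ ≤ 1 / (2 * Real.pi) ^ 3 *
      ((|l1| + |l2| * (8 * Real.pi / 3)) * ((2 * Real.pi) ^ 3 * ∫ x, ‖u x‖ ^ 4)) := by gcongr
    _ = _ := by field_simp

/-! ### The Sobolev embedding -/

section Sobolev

open scoped Convolution Topology ENNReal NNReal
open ContinuousLinearMap Filter


/-- Mollification commutes with the weak gradient. -/
theorem IsWeakGradient.fderiv_convolution {u : R3 → ℂ} {g : Fin 3 → R3 → ℂ}
    (hg : IsWeakGradient u g) (hu : LocallyIntegrable u) {ρ : R3 → ℝ}
    (hρ : ContDiff ℝ (⊤ : ℕ∞) ρ) (hc : HasCompactSupport ρ) (x : R3) (j : Fin 3) :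
    fderiv ℝ (ρ ⋆[lsmul ℝ ℝ, volume] u) x (EuclideanSpace.single j 1)
      = (ρ ⋆[lsmul ℝ ℝ, volume] g j) x := by
  have hρ1 : ContDiff ℝ 1 ρ := hρ.of_le (by simp)
  rw [(hc.hasFDerivAt_convolution_left (lsmul ℝ ℝ) hρ1 hu x).fderiv]
  have hex := (hc.fderiv ℝ).convolutionExists_left ((lsmul ℝ ℝ : ℝ →L[ℝ] ℂ →L[ℝ] ℂ).precompL R3)
    (hρ1.continuous_fderiv one_ne_zero) hu x
  rw [convolution_def, ContinuousLinearMap.integral_apply hex]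
  have htest : IsTest (fun y => ρ (x - y)) := by
    refine ⟨hρ.comp (contDiff_const.sub contDiff_id), ?_⟩
    exact hc.comp_homeomorph (Homeomorph.subLeft x)
  have hkey := (hg j).2 _ htest
  have hder : ∀ y, fderiv ℝ (fun y => ρ (x - y)) y (EuclideanSpace.single j 1)
      = - fderiv ℝ ρ (x - y) (EuclideanSpace.single j 1) := by
    intro y
    have h := ((hρ1.differentiable one_ne_zero (x - y)).hasFDerivAt.comp y
      ((hasFDerivAt_id y).const_sub x)).fderiv
    rw [Function.comp_def] at h
    rw [h]
    simp
  simp only [hder] at hkey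
  rw [convolution_lsmul_swap]
  have h1 : ∫ t, ρ (x - t) • g j t
      = ∫ y, ((fderiv ℝ ρ (x - y) (EuclideanSpace.single j 1) : ℝ) : ℂ) * u y := by
    simp only [Complex.real_smul]
    rw [← neg_inj, ← hkey, ← integral_neg]
    simp
  rw [h1, ← integral_sub_left_eq_self _ volume x]
  simp [ContinuousLinearMap.precompL_apply]

/-- Convolution with a probability density is a contraction of `L²`: by Jensen's inequality
`|ρ ⋆ g|² ≤ ρ ⋆ |g|²`, and `ρ ⋆ |g|²` has the integral of `|g|²`. -/
theorem eLpNorm_normed_convolution_le (φ : ContDiffBump (0 : R3)) {g : R3 → ℂ}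
    (hg : AEStronglyMeasurable g volume) :
    eLpNorm (φ.normed volume ⋆[lsmul ℝ ℝ, volume] g) 2 volume ≤ eLpNorm g 2 volume := by
  set ρ := φ.normed (volume : Measure R3) with hρ
  have hρm : Measurable (fun t => ENNReal.ofReal (ρ t)) :=
    φ.continuous_normed.measurable.ennreal_ofReal
  -- The convolution is `x ↦ ∫ g (x - t) ∂ν`, where `ν` is the probability measure `ρ dt`.
  set ν : Measure R3 := volume.withDensity (fun t => ENNReal.ofReal (ρ t)) with hν
  have hac : ν ≪ volume := withDensity_absolutelyContinuous _ _
  have hprob : IsProbabilityMeasure ν := by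
    refine ⟨?_⟩
    rw [hν, withDensity_apply _ MeasurableSet.univ, Measure.restrict_univ,
      ← ofReal_integral_eq_lintegral_ofReal φ.integrable_normed
        (Eventually.of_forall φ.nonneg_normed), φ.integral_normed, ENNReal.ofReal_one]
  have hgm : AEStronglyMeasurable (fun p : R3 × R3 => g (p.1 - p.2)) (volume.prod ν) := by
    have h := hg.comp_quasiMeasurePreserving
      (quasiMeasurePreserving_sub_of_right_invariant (volume : Measure R3) volume)
    exact h.mono_ac (Measure.AbsolutelyContinuous.rfl.prod hac)
  have hpt : ∀ x, ‖(ρ ⋆[lsmul ℝ ℝ, volume] g) x‖ₑ ^ (2 : ℝ) ≤ ∫⁻ t, ‖g (x - t)‖ₑ ^ (2 : ℝ) ∂ν := by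
    intro x
    have hgx : AEStronglyMeasurable (fun t => g (x - t)) ν :=
      (hg.comp_quasiMeasurePreserving
        (Measure.measurePreserving_sub_left volume x).quasiMeasurePreserving).mono_ac hac
    have e : (ρ ⋆[lsmul ℝ ℝ, volume] g) x = ∫ t, g (x - t) ∂ν := by
      rw [convolution_lsmul, hν, integral_withDensity_eq_integral_toReal_smul hρm
        (Eventually.of_forall fun _ => ENNReal.ofReal_lt_top)]
      simp only [ENNReal.toReal_ofReal (φ.nonneg_normed _), hρ]
    have h1 : ‖(ρ ⋆[lsmul ℝ ℝ, volume] g) x‖ₑ ≤ eLpNorm (fun t => g (x - t)) 2 ν := by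
      rw [e]
      refine (enorm_integral_le_lintegral_enorm _).trans ?_
      rw [← eLpNorm_one_eq_lintegral_enorm]
      exact eLpNorm_le_eLpNorm_of_exponent_le (by norm_num) hgx
    have h2 := eLpNorm_nnreal_pow_eq_lintegral (μ := ν) (f := fun t => g (x - t))
      (p := 2) (by norm_num)
    calc _ ≤ eLpNorm (fun t => g (x - t)) 2 ν ^ (2 : ℝ) := by gcongr
      _ = _ := by simpa using h2
  have hfin : ∫⁻ x, ‖(ρ ⋆[lsmul ℝ ℝ, volume] g) x‖ₑ ^ (2 : ℝ) ≤ ∫⁻ x, ‖g x‖ₑ ^ (2 : ℝ) := by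
    calc _ ≤ ∫⁻ x, ∫⁻ t, ‖g (x - t)‖ₑ ^ (2 : ℝ) ∂ν := lintegral_mono hpt
      _ = ∫⁻ t, (∫⁻ x, ‖g (x - t)‖ₑ ^ (2 : ℝ)) ∂ν :=
        lintegral_lintegral_swap (hgm.enorm.pow_const _)
      _ = ∫⁻ _, (∫⁻ x, ‖g x‖ₑ ^ (2 : ℝ)) ∂ν := by
        congr 1; ext t
        exact lintegral_sub_right_eq_self (fun x => ‖g x‖ₑ ^ (2 : ℝ)) t
      _ = _ := by simp
  have e1 := eLpNorm_nnreal_pow_eq_lintegral (μ := (volume : Measure R3))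
    (f := ρ ⋆[lsmul ℝ ℝ, volume] g) (p := 2) (by norm_num)
  have e2 := eLpNorm_nnreal_pow_eq_lintegral (μ := (volume : Measure R3)) (f := g)
    (p := 2) (by norm_num)
  simp only [NNReal.coe_ofNat, ENNReal.coe_ofNat] at e1 e2
  rw [← e1, ← e2] at hfin
  exact (ENNReal.rpow_le_rpow_iff (by norm_num)).1 hfin

theorem norm_le_sum_norm_apply_single (L : R3 →L[ℝ] ℂ) :
    ‖L‖ ≤ ∑ j : Fin 3, ‖L (EuclideanSpace.single j 1)‖ := by
  refine L.opNorm_le_bound (Finset.sum_nonneg fun _ _ => norm_nonneg _) fun v => ?_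
  have hv : v = ∑ j : Fin 3, v j • EuclideanSpace.single j (1 : ℝ) := by
    ext i
    simp [Pi.single_apply]
  conv_lhs => rw [hv, map_sum]
  refine (norm_sum_le _ _).trans ?_
  rw [Finset.sum_mul]
  refine Finset.sum_le_sum fun j _ => ?_
  rw [map_smul, norm_smul, mul_comm]
  gcongr
  exact PiLp.norm_apply_le v j

/-- The Sobolev embedding `H¹(ℝ³) ⊂ L⁶(ℝ³)`: mollify and truncate, apply the
Gagliardo–Nirenberg–Sobolev inequality, and pass to the limit with Fatou's lemma. -/
theorem MemH1.memLp_six {u : R3 → ℂ} (hu : MemH1 u) : MemLp u 6 volume := by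
  obtain ⟨hu2, g, hg⟩ := hu
  have hul : LocallyIntegrable u volume := hu2.locallyIntegrable (by norm_num)
  -- The ratio of the outer to the inner radius of the mollifiers stays bounded, as almost everywhere
  -- convergence of the mollified functions requires.
  let φ : ℕ → ContDiffBump (0 : R3) := fun n =>
    ⟨1 / ((n : ℝ) + 1), 2 / ((n : ℝ) + 1), by positivity, by gcongr; norm_num⟩
  let χ : ContDiffBump (0 : R3) := ⟨1, 2, one_pos, one_lt_two⟩
  have hχc : HasCompactSupport (χ : R3 → ℝ) := χ.hasCompactSupport
  have hχs : ContDiff ℝ (⊤ : ℕ∞) (χ : R3 → ℝ) := χ.contDiff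
  obtain ⟨K, hK⟩ := (hχc.fderiv ℝ).exists_bound_of_continuous
    ((hχs.of_le (by simp) : ContDiff ℝ 1 (χ : R3 → ℝ)).continuous_fderiv one_ne_zero)
  have hK0 : 0 ≤ K := (norm_nonneg _).trans (hK 0)
  let w : ℕ → R3 → ℂ := fun n => (φ n).normed volume ⋆[lsmul ℝ ℝ, volume] u
  let a : ℕ → ℝ := fun n => 1 / ((n : ℝ) + 1)
  have ha0 : ∀ n, 0 < a n := fun n => by simp only [a]; positivity
  have ha1 : ∀ n, a n ≤ 1 := fun n => by
    simp only [a]; rw [div_le_one (by positivity)]; linarith [(Nat.cast_nonneg n : (0 : ℝ) ≤ n)]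
  have hat : Tendsto a atTop (𝓝 0) := tendsto_one_div_add_atTop_nhds_zero_nat
  -- Mollification alone does not give compact support, so `w n` is cut off at distance `≈ n`.
  let v : ℕ → R3 → ℂ := fun n x => χ (a n • x) • w n x
  have hws : ∀ n, ContDiff ℝ 1 (w n) := fun n =>
    (φ n).hasCompactSupport_normed.contDiff_convolution_left _ (φ n).contDiff_normed hul
  have hχns : ∀ n, ContDiff ℝ 1 (fun x : R3 => χ (a n • x)) := fun n =>
    (hχs.of_le (by simp)).comp (contDiff_const_smul _)
  have hvs : ∀ n, ContDiff ℝ 1 (v n) := fun n => (hχns n).smul (hws n)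
  have hvc : ∀ n, HasCompactSupport (v n) := fun n =>
    (hχc.comp_smul (ha0 n).ne').smul_right
  have hlim : ∀ᵐ x, Tendsto (fun n => v n x) atTop (𝓝 (u x)) := by
    have h := ContDiffBump.ae_convolution_tendsto_right_of_locallyIntegrable
      (μ := (volume : Measure R3)) (φ := φ) (l := atTop) (K := 2) (g := u) ?_ ?_ hul
    · filter_upwards [h] with x hx
      have h1 : Tendsto (fun n => χ (a n • x)) atTop (𝓝 1) := by
        have hc : Tendsto (fun n => a n • x) atTop (𝓝 ((0 : ℝ) • x)) := hat.smul_const x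
        rw [zero_smul] at hc
        have h0 : χ (0 : R3) = 1 := χ.one_of_mem_closedBall (by simp [χ])
        rw [← h0]
        exact (χ.continuous.tendsto 0).comp hc
      simpa only [one_smul] using h1.smul hx
    · have : Tendsto (fun n : ℕ => 2 * (1 / ((n : ℝ) + 1))) atTop (𝓝 (2 * 0)) :=
        tendsto_one_div_add_atTop_nhds_zero_nat.const_mul 2
      simpa [φ, div_eq_mul_inv] using this
    · refine Eventually.of_forall fun n => le_of_eq ?_
      simp only [φ]; ring
  have hdv : ∀ n x, ‖fderiv ℝ (v n) x‖ ≤ ‖(∑ j, ‖((φ n).normed volume ⋆[lsmul ℝ ℝ, volume] g j) x‖)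
      + K * ‖w n x‖‖ := by
    intro n x
    rw [Real.norm_of_nonneg (by positivity)]
    have hd : fderiv ℝ (v n) x = χ (a n • x) • fderiv ℝ (w n) x
        + (fderiv ℝ (fun x : R3 => χ (a n • x)) x).smulRight (w n x) :=
      fderiv_fun_smul ((hχns n).differentiable one_ne_zero x)
        ((hws n).differentiable one_ne_zero x)
    rw [hd]
    refine (norm_add_le _ _).trans ?_
    gcongr
    · rw [norm_smul, Real.norm_of_nonneg χ.nonneg]
      calc _ ≤ 1 * ‖fderiv ℝ (w n) x‖ := by gcongr; exact χ.le_one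
        _ ≤ _ := by
          rw [one_mul]
          refine (norm_le_sum_norm_apply_single _).trans (le_of_eq ?_)
          refine Finset.sum_congr rfl fun j _ => ?_
          rw [hg.fderiv_convolution hul (φ n).contDiff_normed (φ n).hasCompactSupport_normed]
    · rw [ContinuousLinearMap.norm_smulRight_apply]
      gcongr
      rw [fderiv_comp_smul, norm_smul, Real.norm_of_nonneg (ha0 n).le]
      calc _ ≤ 1 * K := by gcongr; exacts [ha1 n, hK _]
        _ = K := one_mul K
  have hcontg : ∀ n j, Continuous ((φ n).normed volume ⋆[lsmul ℝ ℝ, volume] g j) := fun n j =>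
    ((φ n).hasCompactSupport_normed.contDiff_convolution_left (n := 1) (lsmul ℝ ℝ)
      (φ n).contDiff_normed ((hg j).1.locallyIntegrable (by norm_num))).continuous
  let D : ℝ≥0∞ := (∑ j, eLpNorm (g j) 2 volume) + ENNReal.ofReal K * eLpNorm u 2 volume
  have hD : D ≠ ⊤ := by
    refine ENNReal.add_ne_top.2 ⟨?_, ENNReal.mul_ne_top ENNReal.ofReal_ne_top hu2.2.ne⟩
    exact ENNReal.sum_ne_top.2 fun j _ => (hg j).1.2.ne
  have hgrad : ∀ n, eLpNorm (fderiv ℝ (v n)) 2 volume ≤ D := by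
    intro n
    refine (eLpNorm_mono (hdv n)).trans ?_
    refine (eLpNorm_add_le ?_ ?_ (by norm_num)).trans (add_le_add ?_ ?_)
    · exact (continuous_finsetSum _ fun j _ => (hcontg n j).norm).aestronglyMeasurable
    · exact (continuous_const.mul (hws n).continuous.norm).aestronglyMeasurable
    · have e : (fun x => ∑ j, ‖((φ n).normed volume ⋆[lsmul ℝ ℝ, volume] g j) x‖)
          = ∑ j, fun x => ‖((φ n).normed volume ⋆[lsmul ℝ ℝ, volume] g j) x‖ := by
        ext x; simp
      rw [e]
      refine (eLpNorm_sum_le (fun j _ => (hcontg n j).norm.aestronglyMeasurable)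
        (by norm_num)).trans ?_
      gcongr with j
      rw [eLpNorm_norm]
      exact eLpNorm_normed_convolution_le _ (hg j).1.1
    · have e : (fun x => K * ‖w n x‖) = K • fun x => ‖w n x‖ := by ext x; simp
      rw [e, eLpNorm_const_smul, eLpNorm_norm, Real.enorm_of_nonneg hK0]
      gcongr
      exact eLpNorm_normed_convolution_le _ hu2.1
  have hS : ∀ n, eLpNorm (v n) 6 volume
      ≤ SNormLESNormFDerivOfEqConst ℂ (volume : Measure R3) 2 * D := by
    intro n
    -- The exponents satisfy `1/6 = 1/2 - 1/3`.
    have h := eLpNorm_le_eLpNorm_fderiv_of_eq (volume : Measure R3) (hvs n) (hvc n)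
      (p := 2) (p' := 6) (by norm_num) (by simp) (by simp; norm_num)
    refine (by simpa using h : _ ≤ _).trans ?_
    gcongr
    exact hgrad n
  refine ⟨hu2.1, ?_⟩
  have hle := Lp.eLpNorm_le_of_ae_tendsto (Eventually.of_forall hS)
    (fun n => (hvs n).continuous.aestronglyMeasurable) hlim
  exact hle.trans_lt (ENNReal.mul_lt_top ENNReal.coe_lt_top hD.lt_top)

end Sobolev

open Filter
open scoped Topology

/-! ### Dilations -/

theorem integral_comp_inv_smul_R3 {F : Type*} [NormedAddCommGroup F] [NormedSpace ℝ F]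
    (f : R3 → F) {s : ℝ} (hs : 0 < s) :
    ∫ x, f (s⁻¹ • x) = s ^ 3 • ∫ x, f x := by
  rw [Measure.integral_comp_inv_smul_of_nonneg volume f hs.le]
  simp

theorem fourierR3_dilation (f : R3 → ℂ) {s : ℝ} (hs : 0 < s) (ξ : R3) :
    fourierR3 (fun x => f (s⁻¹ • x)) ξ = s ^ 3 • fourierR3 f (s • ξ) := by
  rw [fourierR3, fourierR3, ← integral_comp_inv_smul_R3 _ hs]
  refine integral_congr_ae (Eventually.of_forall fun x => ?_)
  simp only [inner_smul_left, inner_smul_right]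
  congr 5
  simp [hs.ne']

theorem B_dilation (l1 l2 : ℝ) (u : R3 → ℂ) {s : ℝ} (hs : 0 < s) :
    B l1 l2 (fun x => u (s⁻¹ • x)) = s ^ 3 * B l1 l2 u := by
  have h0 := integral_comp_inv_smul_R3 (fun ξ => (l1 + l2 * Khat ξ) *
    ‖fourierR3 (fun x => ((‖u x‖ ^ 2 : ℝ) : ℂ)) ξ‖ ^ 2) (inv_pos.2 hs)
  have h : ∀ ξ, (l1 + l2 * Khat ξ) *
        ‖fourierR3 (fun x => ((‖u (s⁻¹ • x)‖ ^ 2 : ℝ) : ℂ)) ξ‖ ^ 2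
      = s ^ 6 * ((l1 + l2 * Khat (s⁻¹⁻¹ • ξ)) *
        ‖fourierR3 (fun x => ((‖u x‖ ^ 2 : ℝ) : ℂ)) (s⁻¹⁻¹ • ξ)‖ ^ 2) := by
    intro ξ
    rw [fourierR3_dilation (fun x => ((‖u x‖ ^ 2 : ℝ) : ℂ)) hs, norm_smul, inv_inv,
      Khat_smul hs.ne', norm_pow, Real.norm_of_nonneg hs.le]
    ring
  simp only [B, h]
  rw [integral_const_mul, h0, smul_eq_mul]
  field_simp

theorem C_dilation (l3 p : ℝ) (u : R3 → ℂ) {s : ℝ} (hs : 0 < s) :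
    C l3 p (fun x => u (s⁻¹ • x)) = s ^ 3 * C l3 p u := by
  rw [C, C, integral_comp_inv_smul_R3 (fun x => ‖u x‖ ^ p) hs, smul_eq_mul]
  ring

theorem memLp_dilation {u : R3 → ℂ} (hu : MemLp u 2 volume) {s : ℝ} (hs : 0 < s) :
    MemLp (fun x => u (s⁻¹ • x)) 2 volume := by
  have hm : AEStronglyMeasurable (fun x => u (s⁻¹ • x)) volume :=
    hu.1.comp_quasiMeasurePreserving
      (Measure.quasiMeasurePreserving_smul volume (inv_ne_zero hs.ne'))
  refine (memLp_two_iff_integrable_sq_norm hm).2 ?_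
  exact (hu.integrable_norm_pow (by norm_num)).comp_smul (inv_ne_zero hs.ne')

theorem IsWeakGradient.dilation {u : R3 → ℂ} {g : Fin 3 → R3 → ℂ} (hg : IsWeakGradient u g)
    {s : ℝ} (hs : 0 < s) :
    IsWeakGradient (fun x => u (s⁻¹ • x)) (fun j x => ((s⁻¹ : ℝ) : ℂ) * g j (s⁻¹ • x)) := by
  intro j
  refine ⟨(memLp_dilation (hg j).1 hs).const_mul _, ?_⟩
  rintro φ ⟨hφ, hc⟩
  have hψ : IsTest (fun x => φ (s • x)) :=
    ⟨hφ.comp (contDiff_const_smul s), hc.comp_smul hs.ne'⟩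
  have key := (hg j).2 _ hψ
  have e1 := integral_comp_inv_smul_R3 (fun x =>
    ((fderiv ℝ (fun y => φ (s • y)) x (EuclideanSpace.single j 1) : ℝ) : ℂ) * u x) hs
  have e2 := integral_comp_inv_smul_R3 (fun x => ((φ (s • x) : ℝ) : ℂ) * g j x) hs
  rw [key] at e1
  simp only [fderiv_comp_smul, smul_inv_smul₀ hs.ne', _root_.smul_apply,
    smul_eq_mul, Complex.ofReal_mul, mul_assoc] at e1 e2
  rw [integral_const_mul] at e1
  have e3 : ∫ x, ((φ x : ℝ) : ℂ) * (((s⁻¹ : ℝ) : ℂ) * g j (s⁻¹ • x))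
      = ((s⁻¹ : ℝ) : ℂ) * ∫ x, ((φ x : ℝ) : ℂ) * g j (s⁻¹ • x) := by
    rw [← integral_const_mul]
    congr 1; ext x; ring
  rw [smul_neg, ← e2] at e1
  rw [e3, ← mul_neg, ← e1, ← mul_assoc, ← Complex.ofReal_mul, inv_mul_cancel₀ hs.ne']
  simp

theorem A_dilation {u : R3 → ℂ} (hu : MemH1 u) {s : ℝ} (hs : 0 < s) :
    A (fun x => u (s⁻¹ • x)) = s * A u := by
  obtain ⟨-, g, hg⟩ := hu
  have e := integral_comp_inv_smul_R3 (fun x => ∑ j : Fin 3, ‖g j x‖ ^ 2) hs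
  rw [A_eq hg, A_eq (hg.dilation hs)]
  simp only [norm_mul, mul_pow, ← Finset.mul_sum]
  rw [integral_const_mul, e, Complex.norm_real, norm_inv, Real.norm_of_nonneg hs.le, smul_eq_mul]
  field_simp

theorem dilation_mem_S {u : R3 → ℂ} {c : ℝ} (hu : u ∈ S c) {s : ℝ} (hs : 0 < s) :
    (fun x => u (s⁻¹ • x)) ∈ S (s ^ 3 * c) := by
  obtain ⟨⟨h2, g, hg⟩, hc⟩ := hu
  refine ⟨⟨memLp_dilation h2 hs, _, hg.dilation hs⟩, ?_⟩
  rw [integral_comp_inv_smul_R3 (fun x => ‖u x‖ ^ 2) hs, hc, smul_eq_mul]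

/-- Dilation by `s` multiplies the mass and the interaction part of the energy by `s³`, but the
kinetic part only by `s`. -/
theorem energy_dilation (l1 l2 l3 p : ℝ) {u : R3 → ℂ} (hu : MemH1 u) {s : ℝ} (hs : 0 < s) :
    energy l1 l2 l3 p (fun x => u (s⁻¹ • x))
      = s * (1 / 2 * A u) + s ^ 3 * (1 / 2 * B l1 l2 u + 2 / p * C l3 p u) := by
  rw [energy, A_dilation hu hs, B_dilation l1 l2 u hs, C_dilation l3 p u hs]
  ring

/-! ### The lower bound on the energy -/

theorem A_nonneg (u : R3 → ℂ) : 0 ≤ A u :=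
  integral_nonneg fun _ => Finset.sum_nonneg fun _ _ => sq_nonneg _

theorem integrable_norm_rpow_of_memLp_two_of_memLp_six {u : R3 → ℂ} (h2 : MemLp u 2 volume)
    (h6 : MemLp u 6 volume) {q : ℝ} (hq2 : 2 ≤ q) (hq6 : q ≤ 6) :
    Integrable (fun x => ‖u x‖ ^ q) := by
  have i2 : Integrable (fun x => ‖u x‖ ^ 2) := h2.integrable_norm_pow (by norm_num)
  have i6 : Integrable (fun x => ‖u x‖ ^ 6) := h6.integrable_norm_pow (by norm_num)
  refine (i2.add i6).mono' (h2.1.norm.aemeasurable.pow_const q).aestronglyMeasurable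
    (Eventually.of_forall fun x => ?_)
  have hn := norm_nonneg (u x)
  rw [Real.norm_of_nonneg (Real.rpow_nonneg hn q)]
  simp only [Pi.add_apply]
  rcases le_total ‖u x‖ 1 with h | h
  · have := Real.rpow_le_rpow_of_exponent_ge' hn h (by norm_num) hq2
    rw [Real.rpow_ofNat] at this
    linarith [pow_nonneg hn 6]
  · have := Real.rpow_le_rpow_of_exponent_le h hq6
    rw [Real.rpow_ofNat] at this
    linarith [pow_nonneg hn 2]

/-- Since `2 < 4 < p`, a quartic term is absorbed by an arbitrarily small multiple of the
`p`-th power, up to a quadratic term. -/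
theorem exists_pow_four_le {p ε : ℝ} (hp : 4 < p) (hε : 0 < ε) :
    ∃ K : ℝ, 0 ≤ K ∧ ∀ s : ℝ, 0 ≤ s → s ^ 4 ≤ ε * s ^ p + K * s ^ 2 := by
  obtain ⟨k, hk0, hk⟩ : ∃ k : ℝ, 0 < k ∧ ε⁻¹ ≤ k ^ (p - 4) := by
    have h := (tendsto_rpow_atTop (by linarith : 0 < p - 4)).eventually_ge_atTop ε⁻¹
    exact ((eventually_gt_atTop 0).and h).exists
  refine ⟨k ^ 2, by positivity, fun s hs => ?_⟩
  rcases le_total s k with h | h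
  · have h1 : s ^ 2 ≤ k ^ 2 := by gcongr
    have h2 : 0 ≤ ε * s ^ p := by positivity
    nlinarith [sq_nonneg s]
  · have hs0 : 0 < s := hk0.trans_le h
    have h1 : ε⁻¹ ≤ s ^ (p - 4) := hk.trans (Real.rpow_le_rpow hk0.le h (by linarith))
    have h2 : s ^ p = s ^ (p - 4) * s ^ 4 := by
      rw [← Real.rpow_natCast s 4, ← Real.rpow_add hs0]; norm_num
    have h3 : 1 ≤ ε * s ^ (p - 4) := by
      calc (1 : ℝ) = ε * ε⁻¹ := (mul_inv_cancel₀ hε.ne').symm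
        _ ≤ _ := by gcongr
    rw [h2]
    nlinarith [pow_pos hs0 4, mul_nonneg (sq_nonneg k) (sq_nonneg s)]

/-- The energy is bounded below on every sphere: the repulsive power term of order `p > 4`
absorbs the dipolar interaction, which is at most quartic. -/
theorem exists_energy_lower_bound (l1 l2 : ℝ) {l3 p : ℝ} (hl3 : 0 < l3) (hp4 : 4 < p)
    (hp6 : p ≤ 6) : ∃ K : ℝ, ∀ u c, u ∈ S c → -(K * c) ≤ energy l1 l2 l3 p u := by
  set M := |l1| + |l2| * (8 * Real.pi / 3) with hM
  have hM0 : 0 ≤ M := by positivity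
  have hp0 : 0 < p := by linarith
  have hε : 0 < 2 / p * l3 / (M + 1) := by positivity
  obtain ⟨K, hK0, hK⟩ := exists_pow_four_le hp4 hε
  refine ⟨M * K, ?_⟩
  rintro u c ⟨hu, rfl⟩
  have h2 := hu.1
  have h6 := hu.memLp_six
  have i2 : Integrable (fun x => ‖u x‖ ^ 2) := h2.integrable_norm_pow (by norm_num)
  have ip := integrable_norm_rpow_of_memLp_two_of_memLp_six h2 h6 (q := p) (by linarith) hp6
  have i4 := integrable_norm_rpow_of_memLp_two_of_memLp_six h2 h6 (q := 4) (by norm_num)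
    (by norm_num)
  have h4 : MemLp u 4 volume := by
    refine (integrable_norm_rpow_iff h2.1 (by norm_num) (by norm_num)).1 ?_
    simpa using i4
  simp only [Real.rpow_ofNat] at i4
  have hB := (abs_le.1 (abs_B_le l1 l2 h2 h4)).1
  rw [← hM] at hB
  have h4le : ∫ x, ‖u x‖ ^ 4
      ≤ 2 / p * l3 / (M + 1) * (∫ x, ‖u x‖ ^ p) + K * ∫ x, ‖u x‖ ^ 2 := by
    rw [← integral_const_mul, ← integral_const_mul,
      ← integral_add (ip.const_mul _) (i2.const_mul _)]
    exact integral_mono i4 ((ip.const_mul _).add (i2.const_mul _))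
      fun x => hK _ (norm_nonneg _)
  have hP : 0 ≤ ∫ x, ‖u x‖ ^ p := integral_nonneg fun x => Real.rpow_nonneg (norm_nonneg _) _
  have hQ : 0 ≤ ∫ x, ‖u x‖ ^ 2 := integral_nonneg fun x => sq_nonneg _
  have hA := A_nonneg u
  have hfrac : M * (2 / p * l3 / (M + 1)) ≤ 2 / p * l3 := by
    rw [mul_div_assoc', div_le_iff₀ (by positivity)]
    have : 0 ≤ 2 / p * l3 := by positivity
    nlinarith
  have h1 : M * ∫ x, ‖u x‖ ^ 4 ≤ 2 / p * l3 * (∫ x, ‖u x‖ ^ p) + M * K * ∫ x, ‖u x‖ ^ 2 := by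
    calc _ ≤ M * (2 / p * l3 / (M + 1) * (∫ x, ‖u x‖ ^ p) + K * ∫ x, ‖u x‖ ^ 2) := by gcongr
      _ = M * (2 / p * l3 / (M + 1)) * (∫ x, ‖u x‖ ^ p) + M * K * ∫ x, ‖u x‖ ^ 2 := by ring
      _ ≤ _ := by gcongr
  have hMK : 0 ≤ M * K * ∫ x, ‖u x‖ ^ 2 := by positivity
  have hlp : 0 ≤ 2 / p * l3 * ∫ x, ‖u x‖ ^ p := by positivity
  rw [energy, C]
  linarith

/-! ### The constraint sets are nonempty -/

theorem memH1_of_contDiff_of_hasCompactSupport {u : R3 → ℂ} (hu : ContDiff ℝ (⊤ : ℕ∞) u)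
    (hc : HasCompactSupport u) : MemH1 u := by
  have hu1 : ContDiff ℝ 1 u := hu.of_le (by simp)
  have hdc : ∀ j : Fin 3, Continuous (fun x => fderiv ℝ u x (EuclideanSpace.single j 1)) :=
    fun j => (hu1.continuous_fderiv one_ne_zero).clm_apply continuous_const
  have hds : ∀ j : Fin 3,
      HasCompactSupport (fun x => fderiv ℝ u x (EuclideanSpace.single j 1)) :=
    fun j => hc.fderiv_apply ℝ _
  refine ⟨hu.continuous.memLp_of_hasCompactSupport hc,
    fun j x => fderiv ℝ u x (EuclideanSpace.single j 1), fun j =>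
      ⟨(hdc j).memLp_of_hasCompactSupport (hds j), ?_⟩⟩
  rintro φ ⟨hφ, hφc⟩
  have hφ1 : ContDiff ℝ 1 φ := hφ.of_le (by simp)
  have h := integral_bilinear_fderiv_right_eq_neg_left_of_integrable
    (μ := (volume : Measure R3)) (B := ContinuousLinearMap.lsmul ℝ ℝ) (f := φ) (g := u)
    (v := EuclideanSpace.single j 1) ?_ ?_ ?_ (fun x _ => hφ1.differentiable one_ne_zero x)
    (fun x _ => hu1.differentiable one_ne_zero x)
  · simp only [ContinuousLinearMap.lsmul_apply, Complex.real_smul] at h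
    rw [h, neg_neg]
  · exact Continuous.integrable_of_hasCompactSupport
      (((hφ1.continuous_fderiv one_ne_zero).clm_apply continuous_const).smul hu.continuous)
      hc.smul_left
  · exact Continuous.integrable_of_hasCompactSupport (hφ.continuous.smul (hdc j))
      hφc.smul_right
  · exact Continuous.integrable_of_hasCompactSupport (hφ.continuous.smul hu.continuous)
      hφc.smul_right

theorem S_nonempty {c : ℝ} (hc : 0 < c) : (S c).Nonempty := by
  let χ : ContDiffBump (0 : R3) := ⟨1, 2, one_pos, one_lt_two⟩
  let u : R3 → ℂ := fun x => ((χ x : ℝ) : ℂ)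
  have hu : MemH1 u := memH1_of_contDiff_of_hasCompactSupport
    (Complex.ofRealCLM.contDiff.comp χ.contDiff)
    (χ.hasCompactSupport.comp_left (g := ((↑) : ℝ → ℂ)) (by simp))
  have hpos : 0 < ∫ x, ‖u x‖ ^ 2 := by
    have hcont : Continuous (fun x => ‖u x‖ ^ 2) :=
      ((Complex.continuous_ofReal.comp χ.continuous).norm).pow 2
    refine hcont.integral_pos_of_hasCompactSupport_nonneg_nonzero ?_ (fun _ => sq_nonneg _)
      (x := 0) ?_
    · have := χ.hasCompactSupport.comp_left (g := fun r : ℝ => ‖(r : ℂ)‖ ^ 2) (by simp)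
      exact this
    · have h0 : χ (0 : R3) = 1 := χ.one_of_mem_closedBall (by simp [χ])
      simp [u, h0]
  have ht : 0 < c / ∫ x, ‖u x‖ ^ 2 := div_pos hc hpos
  -- Dilate the bump function so that its mass becomes `c`.
  have h := dilation_mem_S (⟨hu, rfl⟩ : u ∈ S (∫ x, ‖u x‖ ^ 2)) (Real.rpow_pos_of_pos ht (1 / 3))
  rw [← Real.rpow_natCast, ← Real.rpow_mul ht.le] at h
  norm_num [hpos.ne'] at h
  exact ⟨_, h⟩

/-! ### The infimum function -/

theorem isGLB_gamma (l1 l2 : ℝ) {l3 p : ℝ} (hl3 : 0 < l3) (hp4 : 4 < p) (hp6 : p ≤ 6)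
    {c : ℝ} (hc : 0 < c) : IsGLB (energy l1 l2 l3 p '' S c) (gamma l1 l2 l3 p c) := by
  rw [gamma, if_neg hc.ne']
  obtain ⟨K, hK⟩ := exists_energy_lower_bound l1 l2 hl3 hp4 hp6
  refine isGLB_csInf ((S_nonempty hc).image _) ⟨-(K * c), ?_⟩
  rintro _ ⟨u, hu, rfl⟩
  exact hK u c hu

theorem gamma_zero (l1 l2 l3 p : ℝ) : gamma l1 l2 l3 p 0 = 0 := by simp [gamma]

/-- Testing `γ(tc)` with the dilate by `t^{1/3}` of a function of mass `c`. The bound is a concave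
function of `t`. -/
theorem gamma_mul_le (l1 l2 : ℝ) {l3 p : ℝ} (hl3 : 0 < l3) (hp4 : 4 < p) (hp6 : p ≤ 6)
    {c t : ℝ} (hc : 0 < c) (ht : 0 ≤ t) {u : R3 → ℂ} (hu : u ∈ S c) :
    gamma l1 l2 l3 p (t * c)
      ≤ t ^ (1 / 3 : ℝ) * (1 / 2 * A u) + t * (1 / 2 * B l1 l2 u + 2 / p * C l3 p u) := by
  rcases ht.eq_or_lt with rfl | ht
  · simp [gamma_zero]
  have hs : 0 < t ^ (1 / 3 : ℝ) := Real.rpow_pos_of_pos ht _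
  have hs3 : (t ^ (1 / 3 : ℝ)) ^ 3 = t := by
    rw [← Real.rpow_natCast, ← Real.rpow_mul ht.le]; norm_num
  have hmem := dilation_mem_S hu hs
  have hE := energy_dilation l1 l2 l3 p hu.1 hs
  rw [hs3] at hmem hE
  rw [← hE]
  exact (isGLB_gamma l1 l2 hl3 hp4 hp6 (mul_pos ht hc)).1 ⟨_, hmem, rfl⟩

theorem concaveOn_gamma (l1 l2 : ℝ) {l3 p : ℝ} (hl3 : 0 < l3) (hp4 : 4 < p) (hp6 : p ≤ 6) :
    ConcaveOn ℝ (Set.Ici 0) (gamma l1 l2 l3 p) := by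
  refine ⟨convex_Ici 0, fun x hx y hy a b ha hb hab => ?_⟩
  simp only [Set.mem_Ici] at hx hy
  simp only [smul_eq_mul]
  have hax := mul_nonneg ha hx
  have hby := mul_nonneg hb hy
  rcases (add_nonneg hax hby).eq_or_lt with h0 | hc
  · have h1 : a * x = 0 := by linarith
    have h2 : b * y = 0 := by linarith
    rw [← h0, gamma_zero]
    have h3 : a * gamma l1 l2 l3 p x = 0 := by
      rcases mul_eq_zero.1 h1 with h | h <;> simp [h, gamma_zero]
    have h4 : b * gamma l1 l2 l3 p y = 0 := by
      rcases mul_eq_zero.1 h2 with h | h <;> simp [h, gamma_zero]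
    linarith
  set c := a * x + b * y with hcdef
  refine (isGLB_gamma l1 l2 hl3 hp4 hp6 hc).2 ?_
  rintro _ ⟨u, hu, rfl⟩
  have hgx := gamma_mul_le l1 l2 hl3 hp4 hp6 hc (div_nonneg hx hc.le) hu
  have hgy := gamma_mul_le l1 l2 hl3 hp4 hp6 hc (div_nonneg hy hc.le) hu
  rw [div_mul_cancel₀ _ hc.ne'] at hgx hgy
  have hlin : a * (x / c) + b * (y / c) = 1 := by
    field_simp
    exact hcdef.symm
  have hconc : a * (x / c) ^ (1 / 3 : ℝ) + b * (y / c) ^ (1 / 3 : ℝ) ≤ 1 := by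
    have h := (Real.concaveOn_rpow (p := 1 / 3) (by norm_num) (by norm_num)).2
      (Set.mem_Ici.2 (div_nonneg hx hc.le)) (Set.mem_Ici.2 (div_nonneg hy hc.le)) ha hb hab
    simpa only [smul_eq_mul, hlin, Real.one_rpow] using h
  have hA : 0 ≤ 1 / 2 * A u := by have := A_nonneg u; positivity
  set D := 1 / 2 * B l1 l2 u + 2 / p * C l3 p u with hD
  calc a * gamma l1 l2 l3 p x + b * gamma l1 l2 l3 p y
      ≤ a * ((x / c) ^ (1 / 3 : ℝ) * (1 / 2 * A u) + x / c * D)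
        + b * ((y / c) ^ (1 / 3 : ℝ) * (1 / 2 * A u) + y / c * D) := by gcongr
    _ = (a * (x / c) ^ (1 / 3 : ℝ) + b * (y / c) ^ (1 / 3 : ℝ)) * (1 / 2 * A u)
        + (a * (x / c) + b * (y / c)) * D := by ring
    _ ≤ 1 * (1 / 2 * A u) + 1 * D := by rw [hlin]; gcongr
    _ = energy l1 l2 l3 p u := by rw [energy, hD]; ring

theorem continuousOn_gamma (l1 l2 : ℝ) {l3 p : ℝ} (hl3 : 0 < l3) (hp4 : 4 < p) (hp6 : p ≤ 6) :
    ContinuousOn (gamma l1 l2 l3 p) (Set.Ici 0) := by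
  have hconc := concaveOn_gamma l1 l2 hl3 hp4 hp6
  intro c hc
  rcases (Set.mem_Ici.1 hc).eq_or_lt with rfl | hc
  · -- At the origin, concavity bounds `γ` from below and a single trial function from above.
    obtain ⟨u, hu⟩ := S_nonempty one_pos
    have hle : ∀ t ∈ Set.Ici (0 : ℝ), gamma l1 l2 l3 p t
        ≤ t ^ (1 / 3 : ℝ) * (1 / 2 * A u) + t * (1 / 2 * B l1 l2 u + 2 / p * C l3 p u) := by
      intro t ht
      simpa using gamma_mul_le l1 l2 hl3 hp4 hp6 one_pos ht hu
    have hge : ∀ t ∈ Set.Icc (0 : ℝ) 1, t * gamma l1 l2 l3 p 1 ≤ gamma l1 l2 l3 p t := by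
      intro t ht
      have h := hconc.2 (Set.mem_Ici.2 le_rfl) (Set.mem_Ici.2 zero_le_one)
        (sub_nonneg.2 ht.2) ht.1 (by ring)
      simpa [gamma_zero] using h
    have hup : Tendsto (fun t : ℝ => t ^ (1 / 3 : ℝ) * (1 / 2 * A u)
        + t * (1 / 2 * B l1 l2 u + 2 / p * C l3 p u)) (𝓝[≥] 0) (𝓝 0) := by
      have hcont : Continuous (fun t : ℝ => t ^ (1 / 3 : ℝ) * (1 / 2 * A u)
          + t * (1 / 2 * B l1 l2 u + 2 / p * C l3 p u)) :=
        ((Real.continuous_rpow_const (by norm_num)).mul_const _).add (continuous_mul_const _)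
      have := (hcont.tendsto 0).mono_left (nhdsWithin_le_nhds (s := Set.Ici 0))
      simpa using this
    have hlo : Tendsto (fun t : ℝ => t * gamma l1 l2 l3 p 1) (𝓝[≥] 0) (𝓝 0) := by
      have := ((continuous_mul_const (gamma l1 l2 l3 p 1)).tendsto 0).mono_left
        (nhdsWithin_le_nhds (s := Set.Ici (0 : ℝ)))
      simpa using this
    rw [ContinuousWithinAt, gamma_zero]
    refine tendsto_of_tendsto_of_tendsto_of_le_of_le' hlo hup ?_ ?_
    · filter_upwards [Icc_mem_nhdsGE (zero_lt_one' ℝ)] with t ht using hge t ht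
    · filter_upwards [self_mem_nhdsWithin] with t ht using hle t ht
  · have h := (hconc.subset Set.Ioi_subset_Ici_self (convex_Ioi 0)).continuousOn isOpen_Ioi
    exact (h.continuousAt (Ioi_mem_nhds hc)).continuousWithinAt

end DipolarGP

theorem mainTheorem6 (l1 l2 l3 p : ℝ) (hl3 : 0 < l3) (hp4 : 4 < p) (hp6 : p ≤ 6) :
    (∀ c : ℝ, 0 < c →
      IsGLB (DipolarGP.energy l1 l2 l3 p '' DipolarGP.S c) (DipolarGP.gamma l1 l2 l3 p c)) ∧
    ConcaveOn ℝ (Set.Ici 0) (DipolarGP.gamma l1 l2 l3 p) ∧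
    ContinuousOn (DipolarGP.gamma l1 l2 l3 p) (Set.Ici 0) ∧
    (∀ c1 c2 : ℝ, 0 < c1 → 0 < c2 →
      DipolarGP.gamma l1 l2 l3 p (c1 + c2)
        = DipolarGP.gamma l1 l2 l3 p c1 + DipolarGP.gamma l1 l2 l3 p c2 →
      ∃ m : ℝ, ∀ c ∈ Set.Icc 0 (c1 + c2), DipolarGP.gamma l1 l2 l3 p c = m * c) :=
  ⟨fun _ hc => DipolarGP.isGLB_gamma l1 l2 hl3 hp4 hp6 hc,
    DipolarGP.concaveOn_gamma l1 l2 hl3 hp4 hp6,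
    DipolarGP.continuousOn_gamma l1 l2 hl3 hp4 hp6,
    fun _ _ h1 h2 h => (DipolarGP.concaveOn_gamma l1 l2 hl3 hp4 hp6).exists_eq_mul_of_add_eq
      (DipolarGP.gamma_zero l1 l2 l3 p) h1 h2 h⟩
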